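/- Let $G$ be a finite graph (parallel edges and loops are permitted; a matching is a set of pairwise disjoint non-loop edges). An edge of $G$ is allowed if it belongs to some maximum matching of $G$. Let $C_1,\dots,C_k$ be the vertex sets of the connected components of the spanning subgraph of $G$ whose edges are the allowed edges; the induced subgraphs $G[C_1],\dots,G[C_k]$ are the factor-components of $G$, and $\mathcal{G}(G)$ denotes the set of all of them. A set $X\subseteq V(G)$ is separating if it is the disjoint union of the vertex sets of one or more factor-components. A graph is factor-critical if for every vertex $v$ it has a matching that covers every vertex except $v$ and does not cover $v$. For a subgraph $H$, $G[X]/H$ denotes the graph obtained from $G[X]$ by contracting $V(H)$ to a single new vertex (the edges with both ends in $V(H)$ are removed). For $G_1,G_2\in\mathcal{G}(G)$, write $G_1\trianglelefteq G_2$ if there is a separating set $X$ with $V(G_1)\cup V(G_2)\subseteq X$ such that $G[X]/G_1$ is factor-critical. Then, for any graph $G$, the binary relation $\trianglelefteq$ is a partial order on $\mathcal{G}(G)$; that is, it is reflexive, transitive and antisymmetric. -/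

import Mathlib

open scoped Classical in
/-- The contraction `G/X`. The set `X` of vertices is replaced by one new vertex, here `none`;
the edges with both ends in `X` are removed, every edge with exactly one end in `X` is moved to
the new vertex (parallel edges are kept), and all other edges are unchanged. -/
noncomputable def Graph.contract {α β : Type*} (G : Graph α β) (X : Set α) :
    Graph (Option α) β where
  vertexSet := insert none (some '' (G.vertexSet \ X))
  IsLink e u v := ∃ x y, G.IsLink e x y ∧ ¬ (x ∈ X ∧ y ∈ X) ∧
    u = (if x ∈ X then none else some x) ∧ v = (if y ∈ X then none else some y)
  isLink_symm e _ := by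
    constructor
    rintro u v ⟨x, y, h, hX, hu, hv⟩
    exact ⟨y, x, h.symm, fun hh => hX hh.symm, hv, hu⟩
  eq_or_eq_of_isLink_of_isLink := by
    rintro e u v u' v' ⟨x, y, h, -, hu, -⟩ ⟨x', y', h', -, hu', hv'⟩
    rcases h.left_eq_or_eq h' with rfl | rfl
    · exact Or.inl (hu.trans hu'.symm)
    · exact Or.inr (hu.trans hv'.symm)
  left_mem_of_isLink := by
    rintro e u v ⟨x, y, h, -, rfl, -⟩
    by_cases hx : x ∈ X
    · simp [hx]
    · simp [hx, h.left_mem]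

namespace Graph

variable {α β : Type*}

/-- A matching: a set of edges, none of them a loop, no two of which share an end. -/
structure IsMatching (G : Graph α β) (M : Set β) : Prop where
  subset : M ⊆ G.edgeSet
  not_isLoopAt : ∀ e ∈ M, ∀ x, ¬ G.IsLoopAt e x
  eq_of_inc : ∀ e ∈ M, ∀ f ∈ M, ∀ x, G.Inc e x → G.Inc f x → e = f

/-- The vertex `v` is covered by the set `M` of edges. -/
def Covers (G : Graph α β) (M : Set β) (v : α) : Prop := ∃ e ∈ M, G.Inc e v

/-- A matching with the greatest number of edges. -/
def IsMaximumMatching (G : Graph α β) (M : Set β) : Prop :=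
  G.IsMatching M ∧ ∀ N, G.IsMatching N → N.encard ≤ M.encard

/-- `M` is a near-perfect matching that exposes `v`:
it covers all vertices except for `v`, and it does not cover `v`. -/
def IsNearPerfectMatchingExposing (G : Graph α β) (M : Set β) (v : α) : Prop :=
  G.IsMatching M ∧ ∀ u ∈ G.vertexSet, G.Covers M u ↔ u ≠ v

/-- For every vertex there is a near-perfect matching that exposes it. -/
def IsFactorCritical (G : Graph α β) : Prop :=
  ∀ v ∈ G.vertexSet, ∃ M, G.IsNearPerfectMatchingExposing M v

/-- An edge is allowed if some maximum matching contains it. -/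
def IsAllowed (G : Graph α β) (e : β) : Prop := ∃ M, G.IsMaximumMatching M ∧ e ∈ M

/-- The spanning subgraph of `G` whose edges are the allowed edges. -/
def allowedSubgraph (G : Graph α β) : Graph α β := G.restrict {e | G.IsAllowed e}

/-- The vertex set of the connected component of `G` that contains the vertex `v`. -/
def componentOf (G : Graph α β) (v : α) : Set α := {u | Relation.ReflTransGen G.Adj v u}

/-- The set of factor-components of `G`: the subgraphs `G[C]`, where `C` is the vertex set of a
connected component of the subgraph determined by the allowed edges. -/
def factorComponents (G : Graph α β) : Set (Graph α β) :=
  {H | ∃ v ∈ G.vertexSet, H = G.induce (G.allowedSubgraph.componentOf v)}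

/-- A set of vertices is separating if it is the union of the vertex sets of one or more
factor-components (distinct factor-components are disjoint, so the union is a disjoint one). -/
def IsSeparating (G : Graph α β) (X : Set α) : Prop :=
  ∃ S ⊆ G.factorComponents, S.Nonempty ∧ X = ⋃ H ∈ S, H.vertexSet

/-- `X` is a critical-inducing set for `G₁` to `G₂`. -/
def IsCriticalInducing (G G₁ G₂ : Graph α β) (X : Set α) : Prop :=
  G.IsSeparating X ∧ G₁.vertexSet ∪ G₂.vertexSet ⊆ X ∧
    ((G.induce X).contract G₁.vertexSet).IsFactorCritical

/-- The relation `G₁ ⊴ G₂` between factor-components of `G`: there is a critical-inducing set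
for `G₁` to `G₂`. -/
def BasilicaLE (G : Graph α β) (G₁ G₂ : G.factorComponents) : Prop :=
  ∃ X, G.IsCriticalInducing G₁ G₂ X

end Graph

/-!
Only the sets of vertices that can be perfectly matched matter. A maximum matching never crosses a
separating set, so a contraction `G[X]/C` of a factor-component is factor-critical if and only if
`X \ C` is matchable and, for every `x ∈ X \ C`, some `c ∈ C` makes `(X \ C) \ {x} ∪ {c}` matchable
(`Graph.isFactorCritical_contract_iff`). Arguments with alternating paths are replaced throughout by
the exchange property of the matchable sets (`SimpleGraph.Matchable.exchange`).

Transitivity: if `X` is critical-inducing for `G₁` to `G₂` and `Y` for `G₂` to `G₃`, then `X ∪ Y` is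
critical-inducing for `G₁` to `G₃` (`SimpleGraph.IsCriticalOver.union`).

Antisymmetry: let `G₁ ⊴ G₂ ⊴ G₁` with disjoint vertex sets `C₁`, `C₂`. By the previous step there is
a single separating set `W` for which both `G[W]/C₁` and `G[W]/C₂` are factor-critical, and `W` is
matchable. Let `K` be the connected component of `G[W \ C₁]` that contains `C₂`. As `G[W]/C₂` is
factor-critical, an alternating path from any vertex of `C₁` to `C₂` must enter `K`; hence
`K` has distinct neighbours `s`, `u` in `C₁` for which `(W \ K) \ {s, u}` is matchable. On the other
hand, call `c`, `c'` in `C₁` equivalent if `c = c'` or `(W \ K) \ {c, c'}` is not matchable. This is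
Kotzig's equivalence relation, whose transitivity (`SimpleGraph.matchable_sdiff_pair_trans`) uses
that `C₁` is connected by allowed edges. Vertices of `C₁` that are joined by an augmenting path
through `K` are equivalent, since otherwise `W` would have a perfect matching that crosses `C₁`. As
`G[W]/C₁` is factor-critical, Gallai's lemma (`SimpleGraph.forall_neighbour_of_connected`)
makes all neighbours of `K` in `C₁` equivalent, contrary to the choice of `s` and `u`
(`SimpleGraph.IsCriticalOver.false_of_disjoint`).
-/

/-! ### Pairings and the exchange property -/

namespace SimpleGraph

variable {α : Type*} {H : SimpleGraph α} {A B D K V W X Y : Set α} {σ τ : α → α}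

/-- A perfect matching of the subgraph induced by `A`, encoded as the map `σ` that sends each vertex
of `A` to its partner; the values of `σ` outside `A` are irrelevant. -/
structure IsPairing (H : SimpleGraph α) (A : Set α) (σ : α → α) : Prop where
  mem : ∀ x ∈ A, σ x ∈ A
  invol : ∀ x ∈ A, σ (σ x) = x
  adj : ∀ x ∈ A, H.Adj x (σ x)

/-- The subgraph induced by `A` has a perfect matching. -/
def Matchable (H : SimpleGraph α) (A : Set α) : Prop := ∃ σ, H.IsPairing A σ

lemma IsPairing.restrict (h : H.IsPairing A σ) (hBA : B ⊆ A) (hB : ∀ x ∈ B, σ x ∈ B) :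
    H.IsPairing B σ :=
  ⟨hB, fun x hx => h.invol x (hBA hx), fun x hx => h.adj x (hBA hx)⟩

lemma IsPairing.sdiff (h : H.IsPairing A σ) (hB : ∀ x ∈ B, x ∈ A → σ x ∈ B) :
    H.IsPairing (A \ B) σ := by
  refine h.restrict Set.sdiff_subset fun x hx => ⟨h.mem x hx.1, fun hxB => hx.2 ?_⟩
  have := hB _ hxB (h.mem x hx.1)
  rwa [h.invol x hx.1] at this

lemma IsPairing.sdiff_pair (h : H.IsPairing A σ) {a : α} (ha : a ∈ A) :
    H.IsPairing (A \ {a, σ a}) σ := by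
  refine h.sdiff ?_
  rintro x (rfl | rfl) hx
  · simp
  · simp [h.invol a ha]

open scoped Classical in
lemma IsPairing.union (h : H.IsPairing A σ) (h' : H.IsPairing B τ) (hd : Disjoint A B) :
    H.IsPairing (A ∪ B) (fun x => if x ∈ A then σ x else τ x) := by
  rw [Set.disjoint_left] at hd
  have hB : ∀ x ∈ B, x ∉ A := fun x hx hA => hd hA hx
  refine ⟨?_, ?_, ?_⟩
  · rintro x (hx | hx)
    · simp [hx, h.mem x hx]
    · simp [hB x hx, h'.mem x hx]
  · rintro x (hx | hx)
    · simp [hx, h.mem x hx, h.invol x hx]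
    · simp [hB x hx, hB _ (h'.mem x hx), h'.invol x hx]
  · rintro x (hx | hx)
    · simp [hx, h.adj x hx]
    · simp [hB x hx, h'.adj x hx]

open scoped Classical in
lemma isPairing_pair {a b : α} (h : H.Adj a b) :
    H.IsPairing {a, b} (fun x => if x = a then b else a) := by
  have := h.ne
  have := h.symm
  constructor <;> grind

lemma Matchable.union (h : H.Matchable A) (h' : H.Matchable B) (hd : Disjoint A B) :
    H.Matchable (A ∪ B) :=
  let ⟨_, hσ⟩ := h
  let ⟨_, hτ⟩ := h'
  ⟨_, hσ.union hτ hd⟩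

/-- Adding an edge to a perfect matching; `A'` is a free variable so that the caller can supply any
description of the enlarged set. -/
lemma Matchable.add_edge {A' : Set α} (h : H.Matchable A) {a b : α} (hab : H.Adj a b) (ha : a ∉ A)
    (hb : b ∉ A) (hA' : A' = A ∪ {a, b}) : H.Matchable A' := by
  subst hA'
  exact h.union ⟨_, isPairing_pair hab⟩ (by simp [ha, hb])

/-- The sets that can be perfectly matched form an even delta-matroid, with a simultaneous
exchange: `b` is the other end of the component containing `a` in the union of the two matchings,
and both matchings are switched along that path. -/
theorem Matchable.exchange (hA : H.Matchable A) (hB : H.Matchable B) (hfin : A.Finite) {a : α}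
    (haA : a ∈ A) (haB : a ∉ B) :
    ∃ b ≠ a, (b ∈ A ∧ b ∉ B ∧ H.Matchable (A \ {a, b}) ∧ H.Matchable (B ∪ {a, b})) ∨
      (b ∈ B ∧ b ∉ A ∧ H.Matchable (insert b (A \ {a})) ∧ H.Matchable (insert a (B \ {b}))) := by
  obtain ⟨n, hn⟩ : ∃ n, A.ncard = n := ⟨_, rfl⟩
  induction n using Nat.strong_induction_on generalizing A B a with
  | _ n ih =>
  obtain ⟨σ, hσ⟩ := hA
  obtain ⟨τ, hτ⟩ := hB
  have ha' := hσ.mem a haA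
  have haa' := hσ.adj a haA
  have hne := haa'.ne
  have hA0 : H.Matchable (A \ {a, σ a}) := ⟨σ, hσ.sdiff_pair haA⟩
  by_cases h1 : σ a ∈ B
  · have hta := hτ.mem _ h1
    have htadj := hτ.adj _ h1
    have hB0 : H.Matchable (B \ {σ a, τ (σ a)}) := ⟨τ, hτ.sdiff_pair h1⟩
    generalize hc : τ (σ a) = c at *
    generalize hd : σ a = d at *
    have := htadj.ne
    have hca : c ≠ a := fun h => haB (h ▸ hta)
    by_cases h2 : c ∈ A
    · obtain ⟨b, hbc, hb⟩ := ih (A \ {a, d}).ncard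
        (hn ▸ Set.ncard_lt_ncard ⟨Set.sdiff_subset, fun h => (h haA).2 (by simp)⟩ hfin)
        hA0 hB0 (hfin.subset Set.sdiff_subset) (a := c) ⟨h2, by simp [hca, this.symm]⟩ (by simp) rfl
      clear ih hA0 hB0 hσ hτ hn hfin
      rcases hb with ⟨hb1, hb2, hb3, hb4⟩ | ⟨hb1, hb2, hb3, hb4⟩
      · refine ⟨b, by grind, Or.inl ⟨by grind, by grind, ?_, ?_⟩⟩
        · exact hb3.add_edge htadj (by grind) (by grind) (by ext; grind)
        · exact hb4.add_edge haa' (by grind) (by grind) (by ext; grind)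
      · refine ⟨b, by grind, Or.inr ⟨by grind, by grind, ?_, ?_⟩⟩
        · exact hb3.add_edge htadj (by grind) (by grind) (by ext; grind)
        · exact hb4.add_edge haa' (by grind) (by grind) (by ext; grind)
    · clear ih hσ hτ hn hfin
      refine ⟨c, hca, Or.inr ⟨hta, h2, ?_, ?_⟩⟩
      · exact hA0.add_edge htadj (by grind) (by grind) (by ext; grind)
      · exact hB0.add_edge haa' (by grind) (by grind) (by ext; grind)
  · exact ⟨σ a, hne.symm, Or.inl ⟨ha', h1, hA0, Matchable.add_edge ⟨τ, hτ⟩ haa' haB h1 rfl⟩⟩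

/-! ### Kotzig's equivalence relation -/

/-- The edge `xy` lies in a perfect matching of the subgraph induced by `V`. -/
def IsAllowedIn (H : SimpleGraph α) (V : Set α) (x y : α) : Prop :=
  x ∈ V ∧ y ∈ V ∧ H.Adj x y ∧ H.Matchable (V \ {x, y})

/-- For the perfect matching `M` of `V` given by `σ`, the vertices that an `M`-alternating path from
`v` with first edge in `M` can reach are closed
under allowed edges. A path that ends with an edge of `M` in `u` exists if and only if
`V \ {v, u}` can be perfectly matched; one that ends with an edge outside `M` extends to
the partner `σ u`. -/
lemma matchable_sdiff_or_of_reflTransGen (hV : V.Finite) (hσ : H.IsPairing V σ) {v u : α}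
    (hv : v ∈ V) (h : Relation.ReflTransGen (H.IsAllowedIn V) v u) :
    u = v ∨ H.Matchable (V \ {v, u}) ∨ (σ u ≠ v ∧ H.Matchable (V \ {v, σ u})) := by
  induction h with
  | refl => exact Or.inl rfl
  | @tail z u hvz' hzu ih =>
    clear hvz'
    obtain ⟨hz, hu, hadj, hm⟩ := hzu
    by_cases huv : u = v
    · exact Or.inl huv
    refine Or.inr ?_
    have hsu := hσ.mem u hu
    have hsz := hσ.mem z hz
    have hsuu := hσ.invol u hu
    have hszz := hσ.invol z hz
    have h1 : H.Matchable (V \ {u, σ u}) := ⟨σ, hσ.sdiff_pair hu⟩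
    have hau := (hσ.adj u hu)
    have haz := (hσ.adj z hz)
    have := hau.ne
    have := haz.ne
    have := hadj.ne
    by_cases hsuv : σ u = v
    · left; rwa [hsuv, Set.pair_comm] at h1
    by_cases hzv : z = v
    · subst hzv; exact Or.inl hm
    by_cases hvz : H.Matchable (V \ {v, z})
    · by_cases hzsu : z = σ u
      · subst hzsu; exact Or.inr ⟨hsuv, hvz⟩
      obtain ⟨b, hb, ⟨hb1, hb2, hb3, -⟩ | ⟨hb1, hb2, hb3, -⟩⟩ :=
        h1.exchange hvz (hV.subset Set.sdiff_subset) (a := v) (by grind) (by grind)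
      · obtain rfl : b = z := by grind
        exact Or.inr ⟨hsuv, hb3.add_edge hadj (by grind) (by grind) (by ext; grind)⟩
      · obtain rfl | rfl : b = u ∨ b = σ u := by grind
        · refine Or.inr ⟨hsuv, ?_⟩
          convert hb3 using 1; ext; grind
        · left
          convert hb3 using 1; ext; grind
    · obtain ⟨hszv, hvz'⟩ := (ih.resolve_left hzv).resolve_left hvz
      by_cases husz : u = σ z
      · subst husz; exact Or.inl hvz'
      left
      obtain ⟨b, hb, ⟨hb1, hb2, hb3, -⟩ | ⟨hb1, hb2, hb3, -⟩⟩ :=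
        hm.exchange hvz' (hV.subset Set.sdiff_subset) (a := v) (by grind) (by grind)
      · obtain rfl : b = σ z := by grind
        exact hb3.add_edge haz (by grind) (by grind) (by ext; grind)
      · obtain rfl | rfl : b = z ∨ b = u := by grind
        · convert hb3 using 1; ext; grind
        · refine absurd ?_ hvz
          convert hb3 using 1; ext; grind

/-- Kotzig: on a set of vertices connected by allowed edges, the relation "`x = y`, or
deleting `x` and `y` destroys all perfect matchings" is transitive. -/
lemma matchable_sdiff_pair_trans (hV : V.Finite) (hM : H.Matchable V) {s u c : α} (hs : s ∈ V)
    (hc : c ∈ V) (hne : s ≠ u) (hcs : c ≠ s) (hcu : c ≠ u) (hsu : H.Matchable (V \ {s, u}))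
    (h : Relation.ReflTransGen (H.IsAllowedIn V) c s) :
    H.Matchable (V \ {c, s}) ∨ H.Matchable (V \ {c, u}) := by
  obtain ⟨σ, hσ⟩ := hM
  have hss := hσ.mem s hs
  have has := hσ.adj s hs
  have := has.ne
  rcases matchable_sdiff_or_of_reflTransGen hV hσ hc h with h | h | ⟨hne', h'⟩
  · exact absurd h.symm hcs
  · exact Or.inl h
  clear h
  by_cases hu : σ s = u
  · exact Or.inr (hu ▸ h')
  obtain ⟨b, hb, ⟨hb1, hb2, hb3, -⟩ | ⟨hb1, hb2, hb3, -⟩⟩ :=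
    hsu.exchange h' (hV.subset Set.sdiff_subset) (a := c) (by grind) (by grind)
  · obtain rfl : b = σ s := by grind
    exact Or.inr (hb3.add_edge has (by grind) (by grind) (by ext; grind))
  · obtain rfl | rfl : b = s ∨ b = u := by grind
    · right
      convert hb3 using 1; ext; grind
    · left
      convert hb3 using 1; ext; grind

/-! ### Critical sets -/

/-- The graph obtained from the subgraph induced by `X` by contracting `C` is factor-critical: the
first part is a near-perfect matching that exposes the contracted vertex, and in the second
part `c` is the end in `C` of the edge that covers the contracted vertex. -/
def IsCriticalOver (H : SimpleGraph α) (X C : Set α) : Prop :=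
  H.Matchable (X \ C) ∧ ∀ x ∈ X \ C, ∃ c ∈ C, H.Matchable (insert c ((X \ C) \ {x}))

/-- For `y` outside `X`, the exchange property, applied to the perfect matching of `Y \ X` and to
a matching exposing `y`, yields an alternating path from `y` that stops on entering `X`; if it
stops outside `C₁`, it is continued by a path inside `X`. -/
lemma IsCriticalOver.union {C₁ C₂ : Set α} (h₁ : H.IsCriticalOver X C₁)
    (h₂ : H.IsCriticalOver Y C₂) (hY : Y.Finite) (h₁X : C₁ ⊆ X) (h₂X : C₂ ⊆ X)
    (hYX : H.Matchable (Y \ X)) : H.IsCriticalOver (X ∪ Y) C₁ := by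
  have hset : (X ∪ Y) \ C₁ = (X \ C₁) ∪ (Y \ X) := by ext; grind
  rw [IsCriticalOver, hset]
  refine ⟨h₁.1.union hYX (Set.disjoint_left.2 (by grind)), ?_⟩
  rintro x (hx | hx)
  · obtain ⟨c, hc, hm⟩ := h₁.2 x hx
    refine ⟨c, hc, ?_⟩
    have := hm.union hYX (Set.disjoint_left.2 (by grind))
    convert this using 1; ext; grind
  · obtain ⟨c₀, hc₀, hm⟩ := h₂.2 x (by grind)
    obtain ⟨b, hb, ⟨hb1, hb2, -, -⟩ | ⟨hb1, hb2, hb3, -⟩⟩ :=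
      hYX.exchange hm (hY.subset Set.sdiff_subset) (a := x) hx (by grind)
    · exact absurd hb1 (by grind)
    have hbX : b ∈ X := by grind
    by_cases hbC : b ∈ C₁
    · refine ⟨b, hbC, ?_⟩
      have := h₁.1.union hb3 (Set.disjoint_left.2 (by grind))
      convert this using 1; ext; grind
    · obtain ⟨c, hc, hm'⟩ := h₁.2 b ⟨hbX, hbC⟩
      refine ⟨c, hc, ?_⟩
      have := hm'.union hb3 (Set.disjoint_left.2 (by grind))
      convert this using 1; ext; grind

/-- The subgraph of the edges with at least one end in `K`. -/
def touching (H : SimpleGraph α) (K : Set α) : SimpleGraph α where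
  Adj x y := H.Adj x y ∧ (x ∈ K ∨ y ∈ K)
  symm := ⟨fun _ _ h => ⟨h.1.symm, h.2.symm⟩⟩
  loopless := ⟨fun _ h => h.1.ne rfl⟩

lemma Matchable.touching (h : H.Matchable A) {b : α} (hA : A ⊆ insert b K) :
    (H.touching K).Matchable A := by
  obtain ⟨σ, hσ⟩ := h
  refine ⟨σ, hσ.mem, hσ.invol, fun x hx => ⟨hσ.adj x hx, ?_⟩⟩
  have h1 := hA hx
  have h2 := hA (hσ.mem x hx)
  have := (hσ.adj x hx).ne
  grind

/-- A form of Gallai's lemma. Let `K` be connected, and for every `z ∈ K` let `K \ {z}` together with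
one vertex of `C` be matchable. If a property `R` of the vertices of `C` passes along augmenting
paths through `K` (the pairs `c`, `c'` for which `K` with `c` and `c'` added is matchable), and
some neighbour of `K` in `C` has `R`, then all of them do. The set of `z` whose matching can be
chosen to end in a vertex with `R` is closed under adjacency: by the exchange property, the
matchings for adjacent `z` and `z'` either give an augmenting path or can share their end in `C`.
The graph `H.touching K` rules out that `c` and `c'` are simply matched to each other. -/
lemma forall_neighbour_of_connected {C K : Set α} (hK : K.Finite) (hCK : Disjoint C K)
    (hT : ∀ z ∈ K, ∃ c ∈ C, (H.touching K).Matchable (insert c (K \ {z})))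
    {R : α → Prop}
    (hR : ∀ c ∈ C, ∀ c' ∈ C, c ≠ c' → (H.touching K).Matchable (insert c (insert c' K)) →
      R c → R c')
    {s u z₀ z₁ z₂ : α} (hs : s ∈ C) (hu : u ∈ C) (hRs : R s)
    (hz₁ : Relation.ReflTransGen (fun a b => H.Adj a b ∧ b ∈ K) z₀ z₁)
    (hz₂ : Relation.ReflTransGen (fun a b => H.Adj a b ∧ b ∈ K) z₀ z₂)
    (hz₀ : z₀ ∈ K) (hsz : H.Adj s z₁) (huz : H.Adj u z₂) : R u := by
  rw [Set.disjoint_left] at hCK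
  have key : ∀ z z', H.Adj z z' → z ∈ K → z' ∈ K →
      (∃ c ∈ C, (H.touching K).Matchable (insert c (K \ {z})) ∧ R c) →
      ∃ c ∈ C, (H.touching K).Matchable (insert c (K \ {z'})) ∧ R c := by
    rintro z z' hzz hz hz' ⟨c, hc, hm, hRc⟩
    obtain ⟨c', hc', hm'⟩ := hT z' hz'
    clear hz₁ hz₂ hT
    by_cases hcc : c = c'
    · exact ⟨c', hc', hm', hcc ▸ hRc⟩
    have hne := hzz.ne
    have hcK := hCK hc
    have hcK' := hCK hc'
    have hadj : (H.touching K).Adj z z' := ⟨hzz, Or.inl hz⟩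
    obtain ⟨b, hb, ⟨hb1, hb2, -, hb3⟩ | ⟨hb1, hb2, hb3, -⟩⟩ :=
      hm.exchange hm' ((hK.subset Set.sdiff_subset).insert c) (a := z') (by grind) (by grind)
    · obtain rfl : b = c := by grind
      refine ⟨c', hc', hm', hR b hc c' hc' hcc ?_ hRc⟩
      convert hb3 using 1; ext; grind
    · obtain rfl | rfl : b = c' ∨ b = z := by grind
      · refine ⟨b, hc', hm', hR c hc b hc' hcc ?_ hRc⟩
        exact hb3.add_edge hadj (by grind) (by grind) (by ext; grind)
      · refine ⟨c, hc, ?_, hRc⟩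
        convert hb3 using 1; ext; grind
  have key' : ∀ z, Relation.ReflTransGen (fun a b => H.Adj a b ∧ b ∈ K) z₀ z → z ∈ K ∧
      ((∃ c ∈ C, (H.touching K).Matchable (insert c (K \ {z})) ∧ R c) ↔
      ∃ c ∈ C, (H.touching K).Matchable (insert c (K \ {z₀})) ∧ R c) := by
    intro z hz
    induction hz with
    | refl => exact ⟨hz₀, Iff.rfl⟩
    | tail _ h ih =>
      exact ⟨h.2, (Iff.intro (key _ _ h.1.symm h.2 ih.1) (key _ _ h.1 ih.1 h.2)).trans ih.2⟩
  -- A matching of `K \ {z}` plus `c'` and an edge `cz` form an augmenting path from `c` to `c'`.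
  have edge : ∀ c ∈ C, ∀ c' ∈ C, ∀ z ∈ K, c ≠ c' → H.Adj c z →
      (H.touching K).Matchable (insert c' (K \ {z})) →
      (H.touching K).Matchable (insert c (insert c' K)) := by
    intro c hc c' hc' z hz hcc hcz hm
    have hcK := hCK hc
    have hcK' := hCK hc'
    have hadj : (H.touching K).Adj c z := ⟨hcz, Or.inr hz⟩
    exact hm.add_edge hadj (by grind) (by grind) (by ext; grind)
  have h₁ : ∃ c ∈ C, (H.touching K).Matchable (insert c (K \ {z₁})) ∧ R c := by
    obtain ⟨c, hc, hm⟩ := hT z₁ (key' z₁ hz₁).1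
    refine ⟨c, hc, hm, ?_⟩
    by_cases hcs : s = c
    · exact hcs ▸ hRs
    · exact hR s hs c hc hcs (edge s hs c hc z₁ (key' z₁ hz₁).1 hcs hsz hm) hRs
  obtain ⟨c, hc, hm, hRc⟩ := (key' z₂ hz₂).2.2 ((key' z₁ hz₁).2.1 h₁)
  by_cases hcu : u = c
  · exact hcu ▸ hRc
  · refine hR c hc u hu (Ne.symm hcu) ?_ hRc
    rw [Set.insert_comm]
    exact edge u hu c hc z₂ (key' z₂ hz₂).1 hcu huz hm

/-- Two distinct factor-components of a graph with a perfect matching cannot both leave a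
factor-critical graph when contracted. The hypotheses on `C₁` say that no perfect matching of `W`
leaves `C₁` and that the edges of perfect matchings connect `C₁`; of `C₂` only connectedness is
needed. -/
theorem IsCriticalOver.false_of_disjoint {C₁ C₂ : Set α} (hW : W.Finite) (hM : H.Matchable W)
    (h₁W : C₁ ⊆ W) (h₂W : C₂ ⊆ W) (hd : Disjoint C₁ C₂) {x₁ x₂ : α} (hx₁ : x₁ ∈ C₁)
    (hx₂ : x₂ ∈ C₂) (hcl : ∀ σ, H.IsPairing W σ → ∀ x ∈ C₁, σ x ∈ C₁)
    (hcon₁ : ∀ x ∈ C₁, ∀ y ∈ C₁, Relation.ReflTransGen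
      (fun a b => a ∈ C₁ ∧ b ∈ C₁ ∧ ∃ σ, H.IsPairing W σ ∧ σ a = b) x y)
    (hcon₂ : ∀ y ∈ C₂, Relation.ReflTransGen (fun a b => H.Adj a b ∧ b ∈ C₂) x₂ y)
    (h₁ : H.IsCriticalOver W C₁) (h₂ : H.IsCriticalOver W C₂) : False := by
  rw [Set.disjoint_left] at hd
  -- The component of the graph minus `C₁` that contains `C₂`.
  set K : Set α := {z | Relation.ReflTransGen (fun a b => H.Adj a b ∧ b ∈ W \ C₁) x₂ z}
  have hx₂K : x₂ ∈ K := Relation.ReflTransGen.refl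
  have hKW : K ⊆ W \ C₁ := by
    intro z hz
    rcases Relation.ReflTransGen.cases_tail hz with rfl | ⟨b, -, hb⟩
    · exact ⟨h₂W hx₂, fun h => hd h hx₂⟩
    · exact hb.2
  have hKadj : ∀ z ∈ K, ∀ y ∈ W \ C₁, H.Adj z y → y ∈ K := fun z hz y hy h => hz.tail ⟨h, hy⟩
  have h₂K : C₂ ⊆ K := fun y hy =>
    Relation.ReflTransGen.mono (fun a b h => ⟨h.1, h₂W h.2, fun hb => hd hb h.2⟩) _ _ (hcon₂ y hy)
  have hKcon : ∀ z ∈ K, Relation.ReflTransGen (fun a b => H.Adj a b ∧ b ∈ K) x₂ z := by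
    intro z hz
    induction hz with
    | refl => exact .refl
    | tail hab hbc ih => exact ih.tail ⟨hbc.1, Relation.ReflTransGen.tail hab hbc⟩
  have hCK : Disjoint C₁ K := Set.disjoint_left.2 fun x hx hxK => (hKW hxK).2 hx
  have hKfin : K.Finite := hW.subset fun x hx => (hKW hx).1
  have hcl' : ∀ σ, H.IsPairing W σ → ∀ x ∈ K, σ x ∈ K := by
    intro σ hσ x hx
    have hxW := (hKW hx).1
    refine hKadj x hx _ ⟨hσ.mem x hxW, fun h => (hKW hx).2 ?_⟩ (hσ.adj x hxW)
    have := hcl σ hσ _ h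
    rwa [hσ.invol x hxW] at this
  have hpK : ∀ σ, H.IsPairing W σ → H.IsPairing (W \ K) σ :=
    fun σ hσ => hσ.sdiff fun x hx _ => hcl' σ hσ x hx
  obtain ⟨σ, hσ⟩ := hM
  have hVfin : (W \ K).Finite := hW.subset Set.sdiff_subset
  have hMK : H.Matchable K := ⟨σ, hσ.restrict (fun x hx => (hKW hx).1) (hcl' σ hσ)⟩
  have hMV : H.Matchable (W \ K) := ⟨σ, hpK σ hσ⟩
  have h₁V : C₁ ⊆ W \ K := fun x hx => ⟨h₁W hx, fun h => (hKW h).2 hx⟩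
  have hT : ∀ z ∈ K, ∃ c ∈ C₁, (H.touching K).Matchable (insert c (K \ {z})) := by
    intro z hz
    obtain ⟨d, hd', hm⟩ := h₁.2 z (hKW hz)
    obtain ⟨b, hb, ⟨hb1, hb2, -, -⟩ | ⟨hb1, hb2, hb3, -⟩⟩ :=
      hMK.exchange hm hKfin (a := z) hz (by
        have := hKW hz
        rintro (rfl | h)
        · exact this.2 hd'
        · exact h.2 rfl)
    · exact absurd (Or.inr ⟨hKW hb1, hb⟩) hb2
    refine ⟨b, ?_, hb3.touching (b := b) (Set.insert_subset_insert Set.sdiff_subset)⟩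
    rcases hb1 with rfl | hb1
    · exact hd'
    · exfalso
      obtain ⟨τ, hτ⟩ := hb3
      have hadj := hτ.adj b (by simp)
      rcases hτ.mem b (by simp) with h | h
      · exact hadj.ne h.symm
      · exact hb2 (hKadj _ h.1 b hb1.1 hadj.symm)
  -- Every vertex of `C₁` is joined by an alternating path outside `K` to a neighbour of `K`.
  have hex : ∀ s ∈ C₁, ∃ u ∈ C₁, u ≠ s ∧ (∃ z ∈ K, H.Adj u z) ∧
      H.Matchable ((W \ K) \ {s, u}) := by
    intro s hs
    obtain ⟨y, hy, hm⟩ := h₂.2 s ⟨h₁W hs, fun h => hd hs h⟩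
    have hyK := h₂K hy
    have hsV := h₁V hs
    obtain ⟨b, hb, ⟨hb1, hb2, -, -⟩ | ⟨hb1, hb2, hb3, -⟩⟩ :=
      hMV.exchange hm hVfin (a := s) hsV (by
        rintro (rfl | h)
        · exact hsV.2 hyK
        · exact h.2 rfl)
    · exact absurd (Or.inr ⟨⟨hb1.1, fun h => hb1.2 (h₂K h)⟩, hb⟩) hb2
    have hbW : b ∈ W := by
      rcases hb1 with rfl | hb1
      · exact h₂W hy
      · exact hb1.1.1
    have hbK : b ∈ K := by
      by_contra h
      exact hb2 ⟨hbW, h⟩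
    obtain ⟨τ, hτ⟩ := hb3
    have hadj := hτ.adj b (by simp)
    have hmem : τ b ∈ (W \ K) \ {s} := (hτ.mem b (by simp)).resolve_left hadj.ne'
    refine ⟨τ b, ?_, hmem.2, ⟨b, hbK, hadj.symm⟩, ?_⟩
    · by_contra h
      exact hmem.1.2 (hKadj b hbK _ ⟨hmem.1.1, h⟩ hadj)
    · have h3 : H.Matchable _ := ⟨τ, hτ.sdiff_pair (a := b) (by simp)⟩
      convert h3 using 1
      generalize τ b = u, W \ K = A at hb2
      clear * - hb2
      ext; grind
  -- Otherwise the two matchings form a perfect matching of `W` with an edge leaving `C₁`.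
  have hexcl : ∀ c ∈ C₁, ∀ c' ∈ C₁, c ≠ c' →
      (H.touching K).Matchable (insert c (insert c' K)) → ¬ H.Matchable ((W \ K) \ {c, c'}) := by
    rintro c hc c' hc' hcc ⟨ρ, hρ⟩ ⟨τ, hτ⟩
    have hρ' : H.IsPairing _ ρ := ⟨hρ.mem, hρ.invol, fun x hx => (hρ.adj x hx).1⟩
    have hcV := h₁V hc
    have hcV' := h₁V hc'
    have hKW' : K ⊆ W := fun x hx => (hKW hx).1
    have hu := hρ'.union hτ (Set.disjoint_left.2 (by grind))
    have hset : insert c (insert c' K) ∪ (W \ K) \ {c, c'} = W := by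
      clear * - hcV hcV' hKW'
      ext; grind
    rw [hset] at hu
    have h1 := hcl _ hu c hc
    simp only [Set.mem_insert_iff, true_or, if_true] at h1
    have h2 := (hρ.adj c (by simp)).2.resolve_left hcV.2
    exact (hKW h2).2 h1
  have hcon : ∀ x ∈ C₁, ∀ y ∈ C₁, Relation.ReflTransGen (H.IsAllowedIn (W \ K)) x y := by
    intro x hx y hy
    refine Relation.ReflTransGen.mono ?_ _ _ (hcon₁ x hx y hy)
    rintro a b ⟨ha, hb, τ, hτ, rfl⟩
    exact ⟨h₁V ha, h₁V hb, hτ.adj a (h₁W ha), τ, (hpK τ hτ).sdiff_pair (h₁V ha)⟩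
  -- Two neighbours `s` and `u` of `K` in `C₁` that are joined outside `K` by an alternating path;
  -- Kotzig's relation to `s` passes along augmenting paths through `K`, so it reaches `u`.
  obtain ⟨s, hs, -, ⟨z₁, hz₁, hsz⟩, -⟩ := hex x₁ hx₁
  obtain ⟨u, hu, hus, ⟨z₂, hz₂, huz⟩, hm⟩ := hex s hs
  have := forall_neighbour_of_connected hKfin hCK hT
    (R := fun c => c = s ∨ ¬ H.Matchable ((W \ K) \ {s, c})) ?_ hs hu (Or.inl rfl)
    (hKcon z₁ hz₁) (hKcon z₂ hz₂) hx₂K hsz huz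
  · exact this.elim hus (fun h => h hm)
  · intro c hc c' hc' hcc haug hRc
    by_contra! hcon'
    obtain ⟨hne, hm'⟩ := hcon'
    rcases hRc with rfl | hRc
    · exact hexcl c hc c' hc' hcc haug hm'
    by_cases hcs : c = s
    · subst hcs
      exact hexcl c hc c' hc' hcc haug hm'
    rcases matchable_sdiff_pair_trans hVfin hMV (h₁V hs) (h₁V hc) hne.symm hcs hcc hm'
      (hcon c hc s hs) with h | h
    · rw [Set.pair_comm] at h
      exact hRc h
    · exact hexcl c hc c' hc' hcc haug h

/-! ### Pairings of maximum size -/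

/-- A pairing of the largest possible size, that is, a maximum matching given by the set `A` of
vertices that it covers and the map `σ`. -/
def IsMaxPairing (H : SimpleGraph α) (A : Set α) (σ : α → α) : Prop :=
  H.IsPairing A σ ∧ ∀ B, H.Matchable B → B.ncard ≤ A.ncard

/-- `x` and `y` are joined by an edge of some maximum matching. -/
def MaxAdj (H : SimpleGraph α) (x y : α) : Prop :=
  ∃ A σ, H.IsMaxPairing A σ ∧ x ∈ A ∧ σ x = y

lemma MaxAdj.adj {x y : α} (h : H.MaxAdj x y) : H.Adj x y := by
  obtain ⟨A, σ, hσ, hx, rfl⟩ := h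
  exact hσ.1.adj x hx

lemma MaxAdj.symm {x y : α} (h : H.MaxAdj x y) : H.MaxAdj y x := by
  obtain ⟨A, σ, hσ, hx, rfl⟩ := h
  exact ⟨A, σ, hσ, hσ.1.mem x hx, hσ.1.invol x hx⟩

lemma Matchable.subset_of_support {V : Set α} (hV : ∀ x y, H.Adj x y → x ∈ V)
    (h : H.Matchable A) : A ⊆ V :=
  let ⟨_, hσ⟩ := h
  fun x hx => hV _ _ (hσ.adj x hx)

lemma exists_isMaxPairing {V : Set α} (hVfin : V.Finite) (hV : ∀ x y, H.Adj x y → x ∈ V) :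
    ∃ A σ, H.IsMaxPairing A σ := by
  have hfin : {A | H.Matchable A}.Finite :=
    hVfin.finite_subsets.subset fun A hA => hA.subset_of_support hV
  obtain ⟨A, ⟨σ, hσ⟩, hmax⟩ := Set.exists_max_image _ Set.ncard hfin
    ⟨∅, id, fun _ h => h.elim, fun _ h => h.elim, fun _ h => h.elim⟩
  exact ⟨A, σ, hσ, hmax⟩

lemma IsMaxPairing.isPairing_sdiff (h : H.IsMaxPairing A σ)
    (hD : ∀ x ∈ D, ∀ y, H.MaxAdj x y → y ∈ D) : H.IsPairing (A \ D) σ :=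
  h.1.sdiff fun x hx hxA => hD x hx _ ⟨A, σ, h, hxA, rfl⟩

/-- Every maximum matching covers a matchable set that is closed under allowed edges: otherwise its
part inside `D` could be replaced by a perfect matching of `D`. -/
lemma IsMaxPairing.subset_of_matchable (h : H.IsMaxPairing A σ) (hA : A.Finite) (hDfin : D.Finite)
    (hD : ∀ x ∈ D, ∀ y, H.MaxAdj x y → y ∈ D) (hm : H.Matchable D) : D ⊆ A := by
  have hm' : H.Matchable (A \ D ∪ D) :=
    Matchable.union ⟨σ, h.isPairing_sdiff hD⟩ hm disjoint_sdiff_self_left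
  rw [Set.sdiff_union_self] at hm'
  have := Set.eq_of_subset_of_ncard_le Set.subset_union_left (h.2 _ hm') (hA.union hDfin)
  rw [this]
  exact Set.subset_union_right

lemma IsPairing.maxAdj (hτ : H.IsPairing D τ) (hVfin : V.Finite)
    (hV : ∀ x y, H.Adj x y → x ∈ V) (hD : ∀ x ∈ D, ∀ y, H.MaxAdj x y → y ∈ D) {x : α}
    (hx : x ∈ D) : H.MaxAdj x (τ x) := by
  classical
  obtain ⟨A, σ, h⟩ := exists_isMaxPairing hVfin hV
  have hA : A.Finite := hVfin.subset (Matchable.subset_of_support hV ⟨σ, h.1⟩)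
  have hm : H.Matchable D := ⟨τ, hτ⟩
  have hDA := h.subset_of_matchable hA (hVfin.subset (hm.subset_of_support hV)) hD hm
  have hu := (h.isPairing_sdiff hD).union hτ disjoint_sdiff_self_left
  rw [Set.sdiff_union_of_subset hDA] at hu
  exact ⟨A, _, ⟨hu, h.2⟩, hDA hx, by simp [hx]⟩

lemma MaxAdj.exists_isPairing {x y : α} (h : H.MaxAdj x y) (hVfin : V.Finite)
    (hV : ∀ x y, H.Adj x y → x ∈ V) (hD : ∀ x ∈ D, ∀ y, H.MaxAdj x y → y ∈ D)
    (hm : H.Matchable D) : ∃ τ, H.IsPairing D τ ∧ τ x = y := by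
  obtain ⟨A, σ, hσ, hxA, rfl⟩ := h
  have hA : A.Finite := hVfin.subset (Matchable.subset_of_support hV ⟨σ, hσ.1⟩)
  have hDA := hσ.subset_of_matchable hA (hVfin.subset (hm.subset_of_support hV)) hD hm
  exact ⟨σ, hσ.1.restrict hDA fun z hz => hD z hz _ ⟨A, σ, hσ, hDA hz, rfl⟩, rfl⟩

lemma Matchable.sdiff_of_closed {E : Set α} (hm : H.Matchable D) (hVfin : V.Finite)
    (hV : ∀ x y, H.Adj x y → x ∈ V) (hD : ∀ x ∈ D, ∀ y, H.MaxAdj x y → y ∈ D)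
    (hE : ∀ x ∈ E, ∀ y, H.MaxAdj x y → y ∈ E) : H.Matchable (D \ E) := by
  obtain ⟨τ, hτ⟩ := hm
  exact ⟨τ, hτ.sdiff fun x hx hxD => hE x hx _ (hτ.maxAdj hVfin hV hD hxD)⟩

end SimpleGraph

namespace Graph

variable {α β : Type*} {G : Graph α β} {M N : Set β} {A C X : Set α} {x y v : α} {e : β}

/-! ### Matchings of multigraphs as pairings -/

/-- Adjacency of distinct vertices, as a simple graph. -/
def nonloopGraph (G : Graph α β) : SimpleGraph α where
  Adj x y := x ≠ y ∧ G.Adj x y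
  symm := ⟨fun _ _ h => ⟨h.1.symm, h.2.symm⟩⟩
  loopless := ⟨fun _ h => h.1 rfl⟩

/-- The set of vertices that `M` covers. -/
def coveredSet (G : Graph α β) (M : Set β) : Set α := {v | G.Covers M v}

lemma mem_vertexSet_of_nonloopGraph_adj (x y : α) (h : G.nonloopGraph.Adj x y) :
    x ∈ G.vertexSet := h.2.left_mem

lemma coveredSet_subset : G.coveredSet M ⊆ G.vertexSet := by
  rintro v ⟨e, -, h⟩
  exact h.vertex_mem

lemma IsMatching.exists_isPairing (hM : G.IsMatching M) :
    ∃ σ, G.nonloopGraph.IsPairing (G.coveredSet M) σ ∧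
      ∀ e ∈ M, ∀ x y, G.IsLink e x y → σ x = y := by
  classical
  have h1 : ∀ x, ∃ y, x ∈ G.coveredSet M → ∃ e ∈ M, G.IsLink e x y := by
    intro x
    by_cases hx : x ∈ G.coveredSet M
    · obtain ⟨e, he, y, hy⟩ := hx
      exact ⟨y, fun _ => ⟨e, he, hy⟩⟩
    · exact ⟨x, fun h => absurd h hx⟩
  choose σ hσ using h1
  have h2 : ∀ e ∈ M, ∀ x y, G.IsLink e x y → σ x = y := by
    intro e he x y h
    obtain ⟨f, hf, hl⟩ := hσ x ⟨e, he, y, h⟩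
    obtain rfl := hM.eq_of_inc f hf e he x hl.inc_left h.inc_left
    exact hl.right_unique h
  refine ⟨σ, ⟨?_, ?_, ?_⟩, h2⟩
  · intro x hx
    obtain ⟨e, he, h⟩ := hσ x hx
    exact ⟨e, he, h.inc_right⟩
  · intro x hx
    obtain ⟨e, he, h⟩ := hσ x hx
    exact h2 e he _ _ h.symm
  · intro x hx
    obtain ⟨e, he, h⟩ := hσ x hx
    refine ⟨fun hxx => ?_, e, h⟩
    rw [← hxx] at h
    exact hM.not_isLoopAt e he x h

lemma coveredSet_insert (h : G.IsLink e x y) :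
    G.coveredSet (insert e M) = G.coveredSet M ∪ {x, y} := by
  ext v
  constructor
  · rintro ⟨f, rfl | hf, hv⟩
    · exact Or.inr (hv.eq_or_eq_of_isLink h)
    · exact Or.inl ⟨f, hf, hv⟩
  · rintro (⟨f, hf, hv⟩ | rfl | rfl)
    · exact ⟨f, Or.inr hf, hv⟩
    · exact ⟨e, Or.inl rfl, h.inc_left⟩
    · exact ⟨e, Or.inl rfl, h.inc_right⟩

lemma IsMatching.insert (hM : G.IsMatching M) (h : G.IsLink e x y) (hne : x ≠ y)
    (hx : x ∉ G.coveredSet M) (hy : y ∉ G.coveredSet M) : G.IsMatching (insert e M) := by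
  have key : ∀ f ∈ M, ∀ z, G.Inc e z → G.Inc f z → False := by
    intro f hf z hez hfz
    rcases hez.eq_or_eq_of_isLink h with rfl | rfl
    · exact hx ⟨f, hf, hfz⟩
    · exact hy ⟨f, hf, hfz⟩
  refine ⟨Set.insert_subset h.edge_mem hM.subset, ?_, ?_⟩
  · rintro f (rfl | hf) z hz
    · rcases h.eq_and_eq_or_eq_and_eq hz with ⟨h1, h2⟩ | ⟨h1, h2⟩
      · exact hne (h1.trans h2.symm)
      · exact hne (h1.trans h2.symm)
    · exact hM.not_isLoopAt f hf z hz
  · rintro f (rfl | hf) g (rfl | hg) z hfz hgz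
    · rfl
    · exact (key g hg z hfz hgz).elim
    · exact (key f hf z hgz hfz).elim
    · exact hM.eq_of_inc f hf g hg z hfz hgz

lemma exists_isMatching_of_matchable (hA : A.Finite) (h : G.nonloopGraph.Matchable A) :
    ∃ M, G.IsMatching M ∧ G.coveredSet M = A := by
  obtain ⟨n, hn⟩ : ∃ n, A.ncard = n := ⟨_, rfl⟩
  induction n using Nat.strong_induction_on generalizing A with
  | _ n ih =>
  rcases A.eq_empty_or_nonempty with rfl | ⟨x, hx⟩
  · refine ⟨∅, ⟨Set.empty_subset _, fun _ h => h.elim, fun _ h => h.elim⟩, ?_⟩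
    ext v
    simp [coveredSet, Covers]
  · obtain ⟨σ, hσ⟩ := h
    obtain ⟨hne, e, he⟩ := hσ.adj x hx
    obtain ⟨M, hM, hMA⟩ := ih (A \ {x, σ x}).ncard
      (hn ▸ Set.ncard_lt_ncard ⟨Set.sdiff_subset, fun h => (h hx).2 (by simp)⟩ hA)
      (hA.subset Set.sdiff_subset) ⟨σ, hσ.sdiff_pair hx⟩ rfl
    refine ⟨insert e M, hM.insert he hne (by simp [hMA]) (by simp [hMA]), ?_⟩
    rw [coveredSet_insert he, hMA, Set.sdiff_union_of_subset]
    rintro z (rfl | rfl)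
    · exact hx
    · exact hσ.mem x hx

lemma IsMatching.mono (hM : G.IsMatching M) (h : N ⊆ M) : G.IsMatching N :=
  ⟨h.trans hM.subset, fun e he => hM.not_isLoopAt e (h he),
    fun e he f hf => hM.eq_of_inc e (h he) f (h hf)⟩

lemma IsMatching.finite (hG : G.vertexSet.Finite) (hM : G.IsMatching M) : M.Finite := by
  have h1 : ∀ e ∈ M, ∃ x, G.Inc e x := fun e he =>
    let ⟨x, _, h⟩ := exists_isLink_of_mem_edgeSet (hM.subset he)
    ⟨x, h.inc_left⟩
  rcases M.eq_empty_or_nonempty with rfl | ⟨e₀, he₀⟩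
  · exact Set.finite_empty
  have : Nonempty α := ⟨(h1 e₀ he₀).choose⟩
  choose! f hf using h1
  exact Set.Finite.of_injOn (f := f) (t := G.vertexSet) (fun e he => (hf e he).vertex_mem)
    (fun e he e' he' h => hM.eq_of_inc e he e' he' (f e) (hf e he) (h ▸ hf e' he')) hG

lemma IsMatching.ncard_coveredSet (hG : G.vertexSet.Finite) (hM : G.IsMatching M) :
    (G.coveredSet M).ncard = 2 * M.ncard := by
  have hfin := hM.finite hG
  induction M, hfin using Set.Finite.induction_on with
  | empty =>
    have : G.coveredSet ∅ = ∅ := by ext; simp [coveredSet, Covers]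
    simp [this]
  | @insert e M he hfin ih =>
    have hM' := hM.mono (Set.subset_insert e M)
    obtain ⟨x, y, h⟩ := exists_isLink_of_mem_edgeSet (hM.subset (Set.mem_insert e M))
    have hne : x ≠ y := by
      rintro rfl
      exact hM.not_isLoopAt e (Set.mem_insert e M) x h
    have key : ∀ z, G.Inc e z → z ∉ G.coveredSet M := by
      rintro z hz ⟨f, hf, hfz⟩
      exact he (hM.eq_of_inc e (Or.inl rfl) f (Or.inr hf) z hz hfz ▸ hf)
    have hd : Disjoint (G.coveredSet M) {x, y} := by
      simp [key x h.inc_left, key y h.inc_right]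
    rw [coveredSet_insert h, Set.ncard_union_eq hd (hG.subset coveredSet_subset), ih hM',
      Set.ncard_pair hne, Set.ncard_insert_of_notMem he hfin]
    ring

lemma isMaximumMatching_iff (hG : G.vertexSet.Finite) (hM : G.IsMatching M) :
    G.IsMaximumMatching M ↔
      ∀ B, G.nonloopGraph.Matchable B → B.ncard ≤ (G.coveredSet M).ncard := by
  have hc : ∀ {N}, G.IsMatching N → (N.encard ≤ M.encard ↔ N.ncard ≤ M.ncard) := by
    intro N hN
    rw [← (hM.finite hG).cast_ncard_eq, ← (hN.finite hG).cast_ncard_eq, Nat.cast_le]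
  rw [hM.ncard_coveredSet hG]
  constructor
  · intro h B hB
    obtain ⟨N, hN, rfl⟩ := exists_isMatching_of_matchable
      (hG.subset (hB.subset_of_support mem_vertexSet_of_nonloopGraph_adj)) hB
    rw [hN.ncard_coveredSet hG]
    exact Nat.mul_le_mul_left 2 ((hc hN).1 (h.2 N hN))
  · intro h
    refine ⟨hM, fun N hN => (hc hN).2 ?_⟩
    obtain ⟨σ, hσ, -⟩ := hN.exists_isPairing
    have := h _ ⟨σ, hσ⟩
    rw [hN.ncard_coveredSet hG] at this
    omega

lemma allowedSubgraph_adj_iff (hG : G.vertexSet.Finite) :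
    G.allowedSubgraph.Adj x y ↔ G.nonloopGraph.MaxAdj x y := by
  constructor
  · rintro ⟨e, ⟨M, hM, heM⟩, he⟩
    obtain ⟨σ, hσ, hl⟩ := hM.1.exists_isPairing
    exact ⟨_, σ, ⟨hσ, (isMaximumMatching_iff hG hM.1).1 hM⟩, ⟨e, heM, he.inc_left⟩, hl e heM x y he⟩
  · rintro ⟨A, σ, ⟨hσ, hmax⟩, hx, rfl⟩
    obtain ⟨hne, e, he⟩ := hσ.adj x hx
    have hA : A.Finite :=
      hG.subset (SimpleGraph.Matchable.subset_of_support mem_vertexSet_of_nonloopGraph_adj ⟨σ, hσ⟩)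
    obtain ⟨M, hM, hMA⟩ := exists_isMatching_of_matchable (hA.subset Set.sdiff_subset)
      ⟨σ, hσ.sdiff_pair hx⟩
    have hM' : G.IsMatching (insert e M) := hM.insert he hne (by simp [hMA]) (by simp [hMA])
    have hcov : G.coveredSet (insert e M) = A := by
      rw [coveredSet_insert he, hMA, Set.sdiff_union_of_subset]
      rintro z (rfl | rfl)
      · exact hx
      · exact hσ.mem x hx
    refine ⟨e, ⟨insert e M, (isMaximumMatching_iff hG hM').2 ?_, Or.inl rfl⟩, he⟩
    rwa [hcov]

lemma isFactorCritical_iff (hG : G.vertexSet.Finite) :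
    G.IsFactorCritical ↔ ∀ v ∈ G.vertexSet, G.nonloopGraph.Matchable (G.vertexSet \ {v}) := by
  refine forall₂_congr fun v hv => ⟨?_, ?_⟩
  · rintro ⟨M, hM, hcov⟩
    obtain ⟨σ, hσ, -⟩ := hM.exists_isPairing
    have : G.vertexSet \ {v} = G.coveredSet M := by
      ext u
      exact ⟨fun h => (hcov u h.1).2 h.2,
        fun h => ⟨coveredSet_subset h, (hcov u (coveredSet_subset h)).1 h⟩⟩
    rw [this]
    exact ⟨σ, hσ⟩
  · intro h
    obtain ⟨M, hM, hcov⟩ := exists_isMatching_of_matchable (hG.subset Set.sdiff_subset) h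
    refine ⟨M, hM, fun u hu => ?_⟩
    have : G.Covers M u ↔ u ∈ G.vertexSet \ {v} := by rw [← hcov]; rfl
    rw [this]
    simp [hu]

/-! ### Contraction -/

lemma contract_adj_some (hx : x ∈ X \ C) (hy : y ∈ X \ C) :
    ((G.induce X).contract C).nonloopGraph.Adj (some x) (some y) ↔ G.nonloopGraph.Adj x y := by
  constructor
  · rintro ⟨hne, e, a, b, h, -, ha, hb⟩
    split_ifs at ha hb
    obtain rfl := Option.some.inj ha
    obtain rfl := Option.some.inj hb
    exact ⟨fun h => hne (congrArg some h), e, h.1⟩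
  · rintro ⟨hne, e, h⟩
    exact ⟨fun h => hne (Option.some.inj h), e, x, y, ⟨h, hx.1, hy.1⟩, fun h => hx.2 h.1,
      by simp [hx.2], by simp [hy.2]⟩

lemma contract_adj_none (hCX : C ⊆ X) (hy : y ∈ X \ C) :
    ((G.induce X).contract C).nonloopGraph.Adj none (some y) ↔
      ∃ c ∈ C, G.nonloopGraph.Adj c y := by
  constructor
  · rintro ⟨-, e, a, b, h, -, ha, hb⟩
    split_ifs at ha hb with h1 h2
    obtain rfl := Option.some.inj hb
    exact ⟨a, h1, fun h => hy.2 (h ▸ h1), e, h.1⟩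
  · rintro ⟨c, hc, -, e, h⟩
    exact ⟨nofun, e, c, y, ⟨h, hCX hc, hy.1⟩, fun h => hy.2 h.2, by simp [hc], by simp [hy.2]⟩

lemma matchable_contract_iff (hA : A ⊆ X \ C) :
    ((G.induce X).contract C).nonloopGraph.Matchable (some '' A) ↔ G.nonloopGraph.Matchable A := by
  constructor
  · rintro ⟨τ, hτ⟩
    have h1 : ∀ x ∈ A, some ((τ (some x)).getD x) = τ (some x) := by
      intro x hx
      obtain ⟨y, -, hy⟩ := hτ.mem _ (Set.mem_image_of_mem some hx)
      simp [← hy]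
    have hmem : ∀ x ∈ A, (τ (some x)).getD x ∈ A := by
      intro x hx
      have := hτ.mem _ (Set.mem_image_of_mem some hx)
      rw [← h1 x hx] at this
      simpa using this
    refine ⟨fun x => (τ (some x)).getD x, hmem, ?_, ?_⟩
    · intro x hx
      apply Option.some.inj
      rw [h1 _ (hmem x hx), h1 x hx, hτ.invol _ (Set.mem_image_of_mem some hx)]
    · intro x hx
      rw [← contract_adj_some (hA hx) (hA (hmem x hx)), h1 x hx]
      exact hτ.adj _ (Set.mem_image_of_mem some hx)
  · rintro ⟨σ, hσ⟩
    refine ⟨Option.map σ, ?_, ?_, ?_⟩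
    · rintro _ ⟨x, hx, rfl⟩
      exact ⟨σ x, hσ.mem x hx, rfl⟩
    · rintro _ ⟨x, hx, rfl⟩
      simp [hσ.invol x hx]
    · rintro _ ⟨x, hx, rfl⟩
      exact (contract_adj_some (hA hx) (hA (hσ.mem x hx))).2 (hσ.adj x hx)

lemma isFactorCritical_contract_iff (hX : X.Finite) (hCX : C ⊆ X) :
    ((G.induce X).contract C).IsFactorCritical ↔ G.nonloopGraph.IsCriticalOver X C := by
  have hV : ((G.induce X).contract C).vertexSet = insert none (some '' (X \ C)) := rfl
  have hfin : ((G.induce X).contract C).vertexSet.Finite :=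
    ((hX.subset Set.sdiff_subset).image some).insert none
  rw [isFactorCritical_iff hfin, hV, Set.forall_mem_insert, Set.forall_mem_image]
  refine and_congr ?_ (forall₂_congr fun x hx => ?_)
  · rw [Set.insert_sdiff_of_mem _ (Set.mem_singleton _), Set.sdiff_singleton_eq_self (by simp)]
    exact matchable_contract_iff subset_rfl
  have hset : ∀ k, (insert none (some '' (X \ C)) \ {some x}) \ {none, some k} =
      some '' ((X \ C) \ {x, k}) := by
    intro k
    ext (_ | z) <;> simp [and_assoc]
  constructor
  · rintro ⟨τ, hτ⟩
    have h0 : none ∈ insert none (some '' (X \ C)) \ {some x} := by simp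
    have hadj := hτ.adj _ h0
    have hm := hτ.sdiff_pair h0
    have hmem := hτ.mem _ h0
    rcases hk : τ none with _ | k
    · exact absurd hk.symm hadj.ne
    rw [hk] at hadj hm hmem
    have hkX : k ∈ X \ C := by simpa using hmem.1
    have hkx : k ≠ x := by
      rintro rfl
      exact hmem.2 rfl
    obtain ⟨c, hc, hck⟩ := (contract_adj_none hCX hkX).1 hadj
    rw [hset] at hm
    have hm' := (matchable_contract_iff Set.sdiff_subset).1 ⟨τ, hm⟩
    exact ⟨c, hc, hm'.add_edge hck (by grind) (by grind) (by ext; grind)⟩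
  · rintro ⟨c, hc, σ, hσ⟩
    have h0 : c ∈ insert c ((X \ C) \ {x}) := Set.mem_insert _ _
    have hadj := hσ.adj c h0
    have hk := (hσ.mem c h0).resolve_left hadj.ne'
    have hm := hσ.sdiff_pair h0
    generalize σ c = k at *
    have hm' : G.nonloopGraph.Matchable ((X \ C) \ {x, k}) := by
      refine ⟨σ, ?_⟩
      convert hm using 1
      clear hm hσ
      ext; grind
    refine ((matchable_contract_iff Set.sdiff_subset).2 hm').add_edge
      ((contract_adj_none hCX hk.1).2 ⟨c, hc, hadj⟩) (by simp) (by simp) ?_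
    rw [← hset k, Set.sdiff_union_of_subset]
    rintro z (rfl | rfl)
    · simp
    · exact ⟨Or.inr ⟨k, hk.1, rfl⟩, fun h => hk.2 (Option.some.inj h)⟩

/-! ### Factor-components -/

lemma mem_componentOf_self (H : Graph α β) (v : α) : v ∈ H.componentOf v :=
  Relation.ReflTransGen.refl

lemma componentOf_eq_of_mem {H : Graph α β} {u v : α} (h : u ∈ H.componentOf v) :
    H.componentOf u = H.componentOf v := by
  have hs : Relation.ReflTransGen H.Adj u v := by
    have : Std.Symm H.Adj := ⟨fun _ _ h => h.symm⟩
    exact Std.Symm.symm _ _ h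
  ext w
  exact ⟨fun hw => Relation.ReflTransGen.trans h hw, fun hw => hs.trans hw⟩

lemma componentOf_subset {H : Graph α β} (hv : v ∈ H.vertexSet) :
    H.componentOf v ⊆ H.vertexSet := by
  intro w hw
  rcases Relation.ReflTransGen.cases_tail hw with rfl | ⟨b, -, hb⟩
  · exact hv
  · exact hb.right_mem

lemma reflTransGen_componentOf {H : Graph α β} {y : α} (hx : x ∈ H.componentOf v)
    (hy : y ∈ H.componentOf v) : Relation.ReflTransGen
      (fun a b => a ∈ H.componentOf v ∧ b ∈ H.componentOf v ∧ H.Adj a b) x y := by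
  have h : Relation.ReflTransGen H.Adj x y := by
    rw [← componentOf_eq_of_mem hx] at hy
    exact hy
  clear hy
  induction h with
  | refl => exact .refl
  | tail hab hbc ih =>
    have hb := Relation.ReflTransGen.trans hx hab
    exact ih.tail ⟨hb, hb.tail hbc, hbc⟩

lemma maxAdj_closed_componentOf (hG : G.vertexSet.Finite) (v : α) :
    ∀ x ∈ G.allowedSubgraph.componentOf v, ∀ y, G.nonloopGraph.MaxAdj x y →
      y ∈ G.allowedSubgraph.componentOf v :=
  fun _ hx _ h => Relation.ReflTransGen.tail hx ((allowedSubgraph_adj_iff hG).2 h)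

lemma IsSeparating.subset (h : G.IsSeparating X) : X ⊆ G.vertexSet := by
  obtain ⟨S, hS, -, rfl⟩ := h
  intro x hx
  obtain ⟨H, hH, hx⟩ := Set.mem_iUnion₂.1 hx
  obtain ⟨v, hv, rfl⟩ := hS hH
  exact componentOf_subset (H := G.allowedSubgraph) hv hx

lemma IsSeparating.maxAdj_closed (hG : G.vertexSet.Finite) (h : G.IsSeparating X) :
    ∀ x ∈ X, ∀ y, G.nonloopGraph.MaxAdj x y → y ∈ X := by
  obtain ⟨S, hS, -, rfl⟩ := h
  intro x hx y hxy
  obtain ⟨H, hH, hx⟩ := Set.mem_iUnion₂.1 hx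
  refine Set.mem_iUnion₂.2 ⟨H, hH, ?_⟩
  obtain ⟨v, hv, rfl⟩ := hS hH
  exact maxAdj_closed_componentOf hG v x hx y hxy

lemma IsSeparating.union {Y : Set α} (hX : G.IsSeparating X) (hY : G.IsSeparating Y) :
    G.IsSeparating (X ∪ Y) := by
  obtain ⟨S, hS, hne, rfl⟩ := hX
  obtain ⟨T, hT, -, rfl⟩ := hY
  exact ⟨S ∪ T, Set.union_subset hS hT, hne.mono Set.subset_union_left,
    (Set.biUnion_union S T _).symm⟩

/-! ### The order -/

lemma IsCriticalInducing.isCriticalOver {G₁ G₂ : Graph α β} (hG : G.vertexSet.Finite)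
    (h : G.IsCriticalInducing G₁ G₂ X) : G.nonloopGraph.IsCriticalOver X G₁.vertexSet :=
  (isFactorCritical_contract_iff (hG.subset h.1.subset) (Set.union_subset_iff.1 h.2.1).1).1 h.2.2

/-- Critical-inducing sets compose by union; this carries the transitivity of `⊴`. -/
lemma isCriticalOver_union_of_isCriticalInducing {G₁ G₂ G₃ : Graph α β} {Y : Set α}
    (hG : G.vertexSet.Finite) (h₂ : G₂ ∈ G.factorComponents)
    (hX : G.IsCriticalInducing G₁ G₂ X) (hY : G.IsCriticalInducing G₂ G₃ Y) :
    G.nonloopGraph.IsCriticalOver (X ∪ Y) G₁.vertexSet := by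
  have hX' := hX.isCriticalOver hG
  have hY' := hY.isCriticalOver hG
  obtain ⟨h₁X, h₂X⟩ := Set.union_subset_iff.1 hX.2.1
  refine hX'.union hY' (hG.subset hY.1.subset) h₁X h₂X ?_
  have hclX := hX.1.maxAdj_closed hG
  have hclY := hY.1.maxAdj_closed hG
  obtain ⟨v, hv, rfl⟩ := h₂
  have hm := hY'.1.sdiff_of_closed (E := X) hG mem_vertexSet_of_nonloopGraph_adj ?_ hclX
  · convert hm using 1
    rw [Set.sdiff_sdiff, Set.union_eq_right.2 h₂X]
  · exact fun x hx y hxy => ⟨hclY x hx.1 y hxy,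
      fun hy => hx.2 (maxAdj_closed_componentOf hG v y hy x hxy.symm)⟩

lemma basilicaLE_antisymm (hG : G.vertexSet.Finite) {G₁ G₂ : Graph α β}
    (h₁ : G₁ ∈ G.factorComponents) (h₂ : G₂ ∈ G.factorComponents) {Y : Set α}
    (hX : G.IsCriticalInducing G₁ G₂ X) (hY : G.IsCriticalInducing G₂ G₁ Y) : G₁ = G₂ := by
  have hW₁ := isCriticalOver_union_of_isCriticalInducing hG h₂ hX hY
  have hW₂ := isCriticalOver_union_of_isCriticalInducing hG h₁ hY hX
  rw [Set.union_comm] at hW₂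
  have hsep := hX.1.union hY.1
  have hcl := hsep.maxAdj_closed hG
  obtain ⟨h₁X, h₂X⟩ := Set.union_subset_iff.1 hX.2.1
  have hX' := hX.isCriticalOver hG
  have hY' := hY.isCriticalOver hG
  have h₁Y := (Set.union_subset_iff.1 hY.2.1).2
  have hclY := hY.1.maxAdj_closed hG
  obtain ⟨v₁, hv₁, rfl⟩ := h₁
  obtain ⟨v₂, hv₂, rfl⟩ := h₂
  simp only [Graph.vertexSet_induce] at *
  set C₁ := G.allowedSubgraph.componentOf v₁ with hC₁
  set C₂ := G.allowedSubgraph.componentOf v₂ with hC₂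
  have hcl₁ : ∀ x ∈ C₁, ∀ y, G.nonloopGraph.MaxAdj x y → y ∈ C₁ := maxAdj_closed_componentOf hG v₁
  have hcl₂ : ∀ x ∈ C₂, ∀ y, G.nonloopGraph.MaxAdj x y → y ∈ C₂ := maxAdj_closed_componentOf hG v₂
  by_contra hne
  have hd : Disjoint C₁ C₂ := Set.disjoint_left.2 fun z hz₁ hz₂ => hne <| by
    rw [hC₁, hC₂, ← componentOf_eq_of_mem hz₁, ← componentOf_eq_of_mem hz₂]
  have hV := mem_vertexSet_of_nonloopGraph_adj (G := G)
  -- `C₁` has a perfect matching, as it lies in the matchable set `Y \ C₂`.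
  have hmC₁ : G.nonloopGraph.Matchable C₁ := by
    obtain ⟨τ, hτ⟩ := hY'.1
    have hsub : C₁ ⊆ Y \ C₂ := fun x hx => ⟨h₁Y hx, Set.disjoint_left.1 hd hx⟩
    refine ⟨τ, hτ.restrict hsub fun x hx => hcl₁ x hx _ (hτ.maxAdj hG hV ?_ (hsub hx))⟩
    exact fun x hx y hxy => ⟨hclY x hx.1 y hxy, fun hy => hx.2 (hcl₂ y hy x hxy.symm)⟩
  have h₁W : C₁ ⊆ X ∪ Y := h₁X.trans Set.subset_union_left
  have hM : G.nonloopGraph.Matchable (X ∪ Y) := by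
    have := hW₁.1.union hmC₁ disjoint_sdiff_self_left
    rwa [Set.sdiff_union_of_subset h₁W] at this
  refine SimpleGraph.IsCriticalOver.false_of_disjoint (hG.subset hsep.subset) hM h₁W
    (h₂X.trans Set.subset_union_left) hd (mem_componentOf_self _ v₁) (mem_componentOf_self _ v₂)
    ?_ ?_ ?_ hW₁ hW₂
  · exact fun σ hσ x hx => hcl₁ x hx _ (hσ.maxAdj hG hV hcl (h₁W hx))
  · intro x hx y hy
    refine Relation.ReflTransGen.mono ?_ _ _ (reflTransGen_componentOf hx hy)
    rintro a b ⟨ha, hb, hab⟩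
    exact ⟨ha, hb, ((allowedSubgraph_adj_iff hG).1 hab).exists_isPairing hG hV hcl hM⟩
  · intro y hy
    refine Relation.ReflTransGen.mono ?_ _ _
      (reflTransGen_componentOf (mem_componentOf_self _ v₂) hy)
    rintro a b ⟨-, hb, hab⟩
    exact ⟨((allowedSubgraph_adj_iff hG).1 hab).adj, hb⟩

end Graph

theorem theorem6 {α β : Type*} (G : Graph α β) (hG : G.vertexSet.Finite) :
    IsPartialOrder G.factorComponents G.BasilicaLE where
  refl := by
    rintro ⟨G₁, h₁⟩
    have hsep : G.IsSeparating G₁.vertexSet :=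
      ⟨{G₁}, Set.singleton_subset_iff.2 h₁, Set.singleton_nonempty _, by simp⟩
    refine ⟨G₁.vertexSet, hsep, by simp, ?_⟩
    rw [Graph.isFactorCritical_contract_iff (hG.subset hsep.subset) subset_rfl,
      SimpleGraph.IsCriticalOver, Set.sdiff_self]
    exact ⟨⟨id, fun _ h => h.elim, fun _ h => h.elim, fun _ h => h.elim⟩, fun _ h => h.elim⟩
  trans := by
    rintro ⟨G₁, h₁⟩ ⟨G₂, h₂⟩ ⟨G₃, h₃⟩ ⟨X, hX⟩ ⟨Y, hY⟩
    have hsep := hX.1.union hY.1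
    have h₁X := (Set.union_subset_iff.1 hX.2.1).1.trans (Set.subset_union_left (t := Y))
    have h₃Y := (Set.union_subset_iff.1 hY.2.1).2.trans (Set.subset_union_right (s := X))
    exact ⟨X ∪ Y, hsep, Set.union_subset h₁X h₃Y,
      (Graph.isFactorCritical_contract_iff (hG.subset hsep.subset) h₁X).2
        (Graph.isCriticalOver_union_of_isCriticalInducing hG h₂ hX hY)⟩
  antisymm := by
    rintro ⟨G₁, h₁⟩ ⟨G₂, h₂⟩ ⟨X, hX⟩ ⟨Y, hY⟩
    exact Subtype.ext (Graph.basilicaLE_antisymm hG h₁ h₂ hX hY)
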